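/- Let $(M^n,g)$ be an oriented $n$-dimensional smooth Riemannian manifold (possibly with boundary), and let $\alpha\in\Omega^1(M)$ be a smooth real $1$-form. For $0\le p\le n$ let $\Omega^p(M,\mathbb C)$ be the space of smooth complex differential $p$-forms, let $d^M$ be the exterior derivative, and let $*:\Omega^p(M,\mathbb C)\to\Omega^{n-p}(M,\mathbb C)$ be the Hodge star operator of $g$ and the orientation, extended complex linearly. Put $\delta^M=(-1)^{n(p+1)+1}*d^M*$ on $p$-forms with $p\ge 1$ and $\delta^M=0$ on functions, and define $$d^\alpha=d^M+i\,\alpha\wedge,\qquad \delta^\alpha=\delta^M-i\,\alpha^\sharp\lrcorner,\qquad \Delta^\alpha=d^\alpha\delta^\alpha+\delta^\alpha d^\alpha,$$ where $\alpha^\sharp$ is the vector field dual to $\alpha$ with respect to $g$ and $\lrcorner$ is the interior product. Then the magnetic Hodge Laplacian $\Delta^\alpha$ commutes with the Hodge star operator: for all $0\le p\le n$ and all $\omega\in\Omega^p(M,\mathbb C)$, $$\Delta^\alpha(*\omega)=*(\Delta^\alpha\omega).$$ -/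

import Mathlib

open Bundle Set Filter Module
open scoped Manifold ContDiff Topology

namespace MagneticHodge

noncomputable section

/-! ### Linear algebra of one oriented Euclidean space

Complex `p`-forms on a real vector space `V` are the `ℝ`-multilinear alternating maps with values
in `ℂ`, that is, the elements of `Λ^p V^* ⊗ ℂ`. -/

section Linear

variable {V : Type*} [NormedAddCommGroup V] [InnerProductSpace ℝ V] [FiniteDimensional ℝ V]
variable {n : ℕ} [Fact (finrank ℝ V = n)]

/-- The identification of `p` slots followed by `q` slots with `n = p + q` slots. -/
def slots {p q n : ℕ} (h : p + q = n) : Fin p ⊕ Fin q ≃ Fin n :=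
  finSumFinEquiv.trans (finCongr h)

theorem elim_update_slots {p q n : ℕ} (h : p + q = n) {W : Type*} [DecidableEq (Fin q)]
    (w : Fin p → W) (v : Fin q → W) (i : Fin q) (z : W) :
    Sum.elim w (Function.update v i z) ∘ (slots h).symm =
      Function.update (Sum.elim w v ∘ (slots h).symm) (slots h (Sum.inr i)) z := by
  classical
  rw [Sum.elim_update_right, Function.update_comp_equiv, Equiv.symm_symm]

/-- The contraction of the volume form with `w 0, …, w (p - 1)` in its first `p` slots: the
`q`-form `v ↦ vol (w 0, …, w (p - 1), v 0, …, v (q - 1))`. -/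
def volContract (o : Orientation ℝ V (Fin n)) {p q : ℕ} (h : p + q = n) (w : Fin p → V) :
    V [⋀^Fin q]→L[ℝ] ℝ where
  toFun v := o.volumeForm (Sum.elim w v ∘ (slots h).symm)
  map_update_add' v i x y := by
    simp only [elim_update_slots]
    convert! o.volumeForm.map_update_add (Sum.elim w v ∘ (slots h).symm) (slots h (Sum.inr i)) x y
  map_update_smul' v i c x := by
    simp only [elim_update_slots]
    convert! o.volumeForm.map_update_smul (Sum.elim w v ∘ (slots h).symm) (slots h (Sum.inr i)) c x
  map_eq_zero_of_eq' v i j hv hij := by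
    refine o.volumeForm.map_eq_zero_of_eq _ (i := slots h (Sum.inr i)) (j := slots h (Sum.inr j))
      ?_ ?_
    · simpa using hv
    · simpa using hij
  cont := by
    have hvol : Continuous fun v : Fin n → V => o.volumeForm v :=
      (o.volumeForm.mkContinuous 1 fun v => by
        simpa using o.abs_volumeForm_apply_le v).cont
    refine hvol.comp (continuous_pi fun k => ?_)
    obtain ⟨s, rfl⟩ := (slots h).surjective k
    cases s with
    | inl a => simpa using continuous_const
    | inr b => simpa using continuous_apply b

/-- The Hodge star of a complex `p`-form on an oriented Euclidean space of dimension
`n = p + q`, extended complex linearly from real forms. If `e` is an orthonormal basis, then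
`η = ∑_I η (e_I) e^I`, where `I` runs through the increasing multi-indices of length `p`, and
`*η = ∑_I η (e_I) vol (e_I, ·)`; here the sum runs through all multi-indices and is divided by
`p!`. It does not depend on the orthonormal basis, and it is the operator with
`ζ ∧ *η = ⟨ζ, η⟩ vol` for real `ζ` and `η`. -/
def hodgeStar (o : Orientation ℝ V (Fin n)) {p q : ℕ} (h : p + q = n)
    (η : V [⋀^Fin p]→L[ℝ] ℂ) : V [⋀^Fin q]→L[ℝ] ℂ :=
  ((p.factorial : ℂ)⁻¹) • ∑ f : Fin p → Fin (finrank ℝ V),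
    η (fun i => stdOrthonormalBasis ℝ V (f i)) •
      Complex.ofRealCLM.compContinuousAlternatingMap
        (volContract o h fun i => stdOrthonormalBasis ℝ V (f i))

/-- A real `1`-form as a linear functional. -/
def functional (a : V [⋀^Fin 1]→L[ℝ] ℝ) : V →L[ℝ] ℝ :=
  (ContinuousAlternatingMap.ofSubsingleton ℝ V ℝ (0 : Fin 1)).symm a

/-- The exterior product `a ∧ η` of a real `1`-form and a complex `p`-form:
`(a ∧ η) (v 0, …, v p) = ∑ i, (-1)^i a (v i) η (v 0, …, v (i - 1), v (i + 1), …, v p)`. -/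
def wedge {p : ℕ} (a : V [⋀^Fin 1]→L[ℝ] ℝ) (η : V [⋀^Fin p]→L[ℝ] ℂ) :
    V [⋀^Fin (p + 1)]→L[ℝ] ℂ :=
  .alternatizeUncurryFin ((functional a).smulRight η)

/-- The vector `a^♯` that represents the real `1`-form `a`: `⟨a^♯, v⟩ = a v`. -/
def sharp (a : V [⋀^Fin 1]→L[ℝ] ℝ) : V :=
  (InnerProductSpace.toDual ℝ V).symm (functional a)

/-- The interior product `X ⌟ η = η (X, ·, …, ·)`. -/
def interiorProd {p : ℕ} (X : V) (η : V [⋀^Fin (p + 1)]→L[ℝ] ℂ) : V [⋀^Fin p]→L[ℝ] ℂ :=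
  η.curryLeft X

end Linear

/-! ### Differential forms on a manifold -/

section Manifold

variable {E : Type*} [NormedAddCommGroup E] [NormedSpace ℝ E]
  {H : Type*} [TopologicalSpace H] (I : ModelWithCorners ℝ E H)
  (M : Type*) [TopologicalSpace M] [ChartedSpace H M]

/-- Differential `p`-forms on `M` with values in `F`, not yet assumed to be smooth. -/
abbrev Form (F : Type*) [NormedAddCommGroup F] [NormedSpace ℝ F] (p : ℕ) : Type _ :=
  ∀ x : M, TangentSpace I x [⋀^Fin p]→L[ℝ] F

variable {I M}

/-- The expression of a form in the chart around `x₀`: its pullback under the inverse chart. -/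
def inChart {F : Type*} [NormedAddCommGroup F] [NormedSpace ℝ F] {p : ℕ}
    (η : Form I M F p) (x₀ : M) (y : E) : E [⋀^Fin p]→L[ℝ] F :=
  (η ((extChartAt I x₀).symm y)).compContinuousLinearMap
    (mfderivWithin 𝓘(ℝ, E) I (extChartAt I x₀).symm (range I) y)

/-- A differential form is smooth if its expressions in the charts of `M` are smooth. -/
def IsSmoothForm {F : Type*} [NormedAddCommGroup F] [NormedSpace ℝ F] {p : ℕ}
    (η : Form I M F p) : Prop :=
  ∀ x₀ : M, ContDiffOn ℝ ∞ (inChart η x₀) (extChartAt I x₀).target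

/-- The exterior derivative `d^M`, computed at `x` in the chart around `x`: the pullback under the
chart of the exterior derivative of the expression of `η` in this chart. (For a smooth form, any
other chart around `x` gives the same value.) -/
def extD {p : ℕ} (η : Form I M ℂ p) : Form I M ℂ (p + 1) := fun x =>
  (extDerivWithin (inChart η x) (range I) (extChartAt I x x)).compContinuousLinearMap
    (mfderiv I 𝓘(ℝ, E) (extChartAt I x) x)

variable (I M) in
/-- An orientation of the manifold `M` of dimension `n`: an orientation of every tangent space
that, in the trivializations of the tangent bundle by charts, is locally constant. -/
structure ManifoldOrientation [IsManifold I 1 M] (n : ℕ) where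
  /-- The orientation of the tangent space at a point. -/
  at_ : ∀ x : M, Orientation ℝ (TangentSpace I x) (Fin n)
  /-- The orientation depends continuously on the point. -/
  locally_const : ∀ x₀ : M, ∃ o₀ : Orientation ℝ E (Fin n), ∀ᶠ x in 𝓝 x₀,
    ∀ hx : x ∈ (trivializationAt E (TangentSpace I) x₀).baseSet,
      Orientation.map (Fin n)
        ((trivializationAt E (TangentSpace I) x₀).linearEquivAt ℝ x hx) (at_ x) = o₀

instance [FiniteDimensional ℝ E] (x : M) : FiniteDimensional ℝ (TangentSpace I x) :=
  inferInstanceAs (FiniteDimensional ℝ E)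

instance {n : ℕ} [h : Fact (finrank ℝ E = n)] (x : M) : Fact (finrank ℝ (TangentSpace I x) = n) :=
  h

variable [FiniteDimensional ℝ E] [IsManifold I 1 M]
  [RiemannianBundle fun x : M => TangentSpace I x] {n : ℕ} [Fact (finrank ℝ E = n)]

/-- The Hodge star `* : Ω^p(M, ℂ) → Ω^q(M, ℂ)`, where `p + q = n`. -/
def formStar (o : ManifoldOrientation I M n) {p q : ℕ} (h : p + q = n) (η : Form I M ℂ p) :
    Form I M ℂ q :=
  fun x => hodgeStar (o.at_ x) h (η x)

/-- The codifferential `δ^M = (-1)^(n (k + 1) + 1) * d^M *` on forms of degree `k = p + 1`.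
(Forms of degree `k > n` vanish. The codifferential of a form of degree `0` is zero, which is
taken care of where the codifferential is used.) -/
def codiff (o : ManifoldOrientation I M n) {p : ℕ} (η : Form I M ℂ (p + 1)) : Form I M ℂ p :=
  if h : p + 1 ≤ n then
    (-1 : ℂ) ^ (n * (p + 1 + 1) + 1) •
      formStar o (p := n - (p + 1) + 1) (q := p) (by omega)
        (extD (formStar o (p := p + 1) (q := n - (p + 1)) (by omega) η))
  else 0

/-- The magnetic differential `d^α = d^M + i α ∧`. -/
def magD (α : Form I M ℝ 1) {p : ℕ} (η : Form I M ℂ p) : Form I M ℂ (p + 1) :=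
  extD η + fun x => Complex.I • wedge (α x) (η x)

/-- The magnetic codifferential `δ^α = δ^M - i α^♯ ⌟` on forms of positive degree. -/
def magCodiff (o : ManifoldOrientation I M n) (α : Form I M ℝ 1) {p : ℕ}
    (η : Form I M ℂ (p + 1)) : Form I M ℂ p :=
  codiff o η - fun x => Complex.I • interiorProd (sharp (α x)) (η x)

/-- The magnetic Hodge Laplacian `Δ^α = d^α δ^α + δ^α d^α`; on forms of degree `0`, the magnetic
codifferential `δ^α` is zero. -/
def magLaplacian (o : ManifoldOrientation I M n) (α : Form I M ℝ 1) :
    {p : ℕ} → Form I M ℂ p → Form I M ℂ p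
  | 0, η => magCodiff o α (magD α η)
  | _ + 1, η => magD α (magCodiff o α η) + magCodiff o α (magD α η)

end Manifold

end

end MagneticHodge

/-! The star interchanges `d^α` and `δ^α` up to sign: `d^α * = (-1)^(p+1) * δ^α` on degree `p + 1`
(`magD_formStar`) and `δ^α * = (-1)^(p+1) * d^α` on degree `p` (`magCodiff_formStar`). Passing `*`
through a product of the two operators produces the same sign twice, so `*` exchanges the summands
`d^α δ^α` and `δ^α d^α`.

The derivative part of these relations is the definition of `δ^M` together with `** = (-1)^(pq)`
(`hodgeStar_hodgeStar`); `extD` enters only through its homogeneity over `ℂ`. The part of order zero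
is linear algebra in one tangent space: `*` exchanges `a ∧` and `a^♯ ⌟` (`wedge_hodgeStar`,
`hodgeStar_wedge`), which is checked on an orthonormal basis. -/

namespace MagneticHodge

noncomputable section

/-! ### Joined tuples of vectors and the signs of moving them -/

section Join

variable {W : Type*}

theorem elim_vecCons_slots {p q m : ℕ} (h : p + 1 + q = m + 1) (h' : p + q = m) (x : W)
    (w : Fin p → W) (v : Fin q → W) :
    Sum.elim (Matrix.vecCons x w) v ∘ (slots h).symm =
      Matrix.vecCons x (Sum.elim w v ∘ (slots h').symm) := by
  funext k
  obtain ⟨s, rfl⟩ := (slots h).surjective k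
  rcases s with a | b
  · refine Fin.cases ?_ (fun a => ?_) a
    · have : slots h (Sum.inl 0) = 0 := by ext; simp [slots]
      rw [Function.comp_apply, Equiv.symm_apply_apply, this]
      simp
    · have : slots h (Sum.inl a.succ) = (slots h' (Sum.inl a)).succ := by
        ext; simp [slots]
      rw [Function.comp_apply, Equiv.symm_apply_apply, this]
      simp
  · have : slots h (Sum.inr b) = (slots h' (Sum.inr b)).succ := by
      ext; simp [slots]; omega
    rw [Function.comp_apply, Equiv.symm_apply_apply, this]
    simp

/-- Isolates one entry of the second block, so that `map_insertNth` can move it to the front of an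
alternating map with an explicit sign. -/
theorem elim_slots_eq_insertNth {p q m : ℕ} (h : p + (q + 1) = m + 1) (h' : p + q = m)
    (w : Fin p → W) (v : Fin (q + 1) → W) (i : Fin (q + 1)) :
    Sum.elim w v ∘ (slots h).symm =
      Fin.insertNth (slots h (Sum.inr i)) (v i)
        (Sum.elim w (i.removeNth v) ∘ (slots h').symm) := by
  rw [Fin.eq_insertNth_iff]
  refine ⟨by simp, ?_⟩
  funext k
  obtain ⟨s, rfl⟩ := (slots h').surjective k
  have key : (slots h (Sum.inr i)).succAbove (slots h' s) =
      slots h (Sum.map id i.succAbove s) := by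
    rcases s with a | b
    · ext
      have : (a : ℕ) < p + i := by omega
      simp [slots, Fin.succAbove, Fin.lt_def, this]
    · ext
      simp only [slots, Fin.succAbove, Fin.lt_def, Equiv.trans_apply, finCongr_apply,
        Sum.map_inr, finSumFinEquiv_apply_right]
      simp
      split_ifs <;> simp <;> omega
  rw [Fin.removeNth, key]
  rcases s with a | b <;> simp [Fin.removeNth]

/-- Induction on the length of `w`: moving `w 0` past the `q` entries of `v` costs `(-1)^q`, and
currying in `w 0` leaves a shorter block to swap. -/
theorem alternatingMap_elim_slots_swap {V N : Type*} [AddCommGroup V] [Module ℝ V]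
    [AddCommGroup N] [Module ℝ N] {p q n : ℕ} (h : p + q = n) (h' : q + p = n)
    (F : V [⋀^Fin n]→ₗ[ℝ] N) (w : Fin p → V) (v : Fin q → V) :
    F (Sum.elim v w ∘ (slots h').symm) =
      (-1 : ℤ) ^ (p * q) • F (Sum.elim w v ∘ (slots h).symm) := by
  induction p generalizing n with
  | zero =>
    have : Sum.elim v w ∘ (slots h').symm = Sum.elim w v ∘ (slots h).symm := by
      funext k
      obtain ⟨s, rfl⟩ := (slots h).surjective k
      rcases s with a | b
      · exact a.elim0
      · have : slots h (Sum.inr b) = slots h' (Sum.inl b) := by ext; simp [slots, finSumFinEquiv]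
        simp only [Function.comp_apply, Equiv.symm_apply_apply]
        rw [this]
        simp
    simp [this]
  | succ p ih =>
    obtain ⟨m, rfl⟩ : ∃ m, n = m + 1 := ⟨p + q, by omega⟩
    have hw : w = Matrix.vecCons (w 0) (Fin.removeNth 0 w) := by
      funext k
      refine Fin.cases ?_ (fun k => ?_) k <;> simp [Fin.tail]
    rw [elim_slots_eq_insertNth h' (by omega : q + p = m) v w 0, F.map_insertNth]
    conv_rhs => rw [hw]
    rw [elim_vecCons_slots h (by omega : p + q = m)]
    have := ih (by omega : p + q = m) (by omega) (F.curryLeft (w 0)) (Fin.removeNth 0 w)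
    simp only [AlternatingMap.curryLeft_apply_apply] at this
    rw [this]
    have hq : ((slots h' (Sum.inr 0) : Fin (m + 1)) : ℕ) = q := by simp [slots]
    rw [hq, smul_smul, ← pow_add]
    congr 2
    ring

end Join

/-! ### The Hodge star of one oriented Euclidean space -/

section Linear

variable {V : Type*} [NormedAddCommGroup V] [InnerProductSpace ℝ V] [FiniteDimensional ℝ V]
variable {n : ℕ} [Fact (finrank ℝ V = n)]

theorem volContract_apply (o : Orientation ℝ V (Fin n)) {p q : ℕ} (h : p + q = n)
    (w : Fin p → V) (v : Fin q → V) :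
    volContract o h w v = o.volumeForm (Sum.elim w v ∘ (slots h).symm) := rfl

theorem volContract_comm (o : Orientation ℝ V (Fin n)) {p q : ℕ} (h : p + q = n)
    (h' : q + p = n) (w : Fin p → V) (v : Fin q → V) :
    volContract o h' v w = (-1) ^ (p * q) * volContract o h w v := by
  rw [volContract_apply, volContract_apply,
    alternatingMap_elim_slots_swap h h' o.volumeForm w v]
  simp

/-- `volContract` is bundled as alternating only in its free block; swapping the blocks on both
sides transfers this to the contracted one. -/
theorem volContract_comp_perm (o : Orientation ℝ V (Fin n)) {p q : ℕ} (h : p + q = n)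
    (w : Fin p → V) (v : Fin q → V) (σ : Equiv.Perm (Fin p)) :
    volContract o h (w ∘ σ) v = (Equiv.Perm.sign σ : ℤ) * volContract o h w v := by
  have h' : q + p = n := by omega
  have := (volContract o h' v).toAlternatingMap.map_perm w σ
  rw [volContract_comm o h' h, volContract_comm o h' h v w]
  simp only [ContinuousAlternatingMap.coe_toAlternatingMap] at this
  rw [this, Units.smul_def, zsmul_eq_mul]
  ring

theorem volContract_eq_zero (o : Orientation ℝ V (Fin n)) {p q : ℕ} (h : p + q = n)
    {w : Fin p → V} {v : Fin q → V} (hwv : ¬ Function.Injective (Sum.elim w v)) :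
    volContract o h w v = 0 := by
  rw [volContract_apply]
  refine o.volumeForm.map_eq_zero_of_not_injective _ fun hi => hwv ?_
  have := hi.comp (slots h).injective
  simpa [Function.comp_assoc] using this

/-- The joined tuple is a reindexed orthonormal basis, on which the volume form is `±1`. -/
theorem volContract_sq (o : Orientation ℝ V (Fin n)) {p q : ℕ} (h : p + q = n)
    {ι : Type*} [Fintype ι] (e : OrthonormalBasis ι ℝ V)
    {f : Fin p → ι} {g : Fin q → ι} (hfg : Function.Bijective (Sum.elim f g)) :
    volContract o h (e ∘ f) (e ∘ g) * volContract o h (e ∘ f) (e ∘ g) = 1 := by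
  have := o.abs_volumeForm_apply_of_orthonormal
    (e.reindex ((slots h).symm.trans (Equiv.ofBijective _ hfg)).symm)
  rw [volContract_apply, ← Sum.comp_elim, ← abs_mul_abs_self]
  have h2 : (e.reindex ((slots h).symm.trans (Equiv.ofBijective _ hfg)).symm : Fin n → V) =
      (e ∘ Sum.elim f g) ∘ (slots h).symm := by
    funext k; simp
  rw [h2] at this
  rw [this, one_mul]

theorem exists_bijective_elim {ι : Type*} [Fintype ι] {p q : ℕ} (h : p + q = Fintype.card ι)
    {g : Fin q → ι} (hg : Function.Injective g) :
    ∃ f : Fin p → ι, Function.Bijective (Sum.elim f g) := by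
  classical
  have hc : Fintype.card {i // i ∉ Set.range g} = p := by
    have h1 := Fintype.card_subtype_compl (fun i => i ∈ Set.range g)
    have h2 : Fintype.card {i // i ∈ Set.range g} = q := by
      rw [← Nat.card_eq_fintype_card]
      exact (Nat.card_congr (Equiv.ofInjective g hg).symm).trans (by simp)
    omega
  let φ := (Fintype.equivFinOfCardEq hc).symm
  refine ⟨fun a => (φ a : ι), Function.Injective.bijective_of_nat_card_le ?_ ?_⟩
  · refine Function.Injective.sumElim (Subtype.val_injective.comp φ.injective) hg ?_
    intro a b hab
    exact (φ a).2 ⟨b, hab.symm⟩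
  · simp [← h]

theorem hodgeStar_apply (o : Orientation ℝ V (Fin n)) {p q : ℕ} (h : p + q = n)
    (η : V [⋀^Fin p]→L[ℝ] ℂ) (v : Fin q → V) :
    hodgeStar o h η v = (p.factorial : ℂ)⁻¹ * ∑ k : Fin p → Fin (finrank ℝ V),
      η (stdOrthonormalBasis ℝ V ∘ k) *
        (volContract o h (stdOrthonormalBasis ℝ V ∘ k) v : ℝ) := by
  simp only [hodgeStar, ContinuousAlternatingMap.smul_apply, smul_eq_mul,
    ContinuousAlternatingMap.sum_apply]
  rfl

/-- The value of `*η` on basis vectors, in terms of the complementary basis vectors. -/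
theorem hodgeStar_apply_basis (o : Orientation ℝ V (Fin n)) {p q : ℕ} (h : p + q = n)
    (η : V [⋀^Fin p]→L[ℝ] ℂ) {f : Fin p → Fin (finrank ℝ V)} {g : Fin q → Fin (finrank ℝ V)}
    (hfg : Function.Bijective (Sum.elim f g)) :
    hodgeStar o h η (stdOrthonormalBasis ℝ V ∘ g) =
      η (stdOrthonormalBasis ℝ V ∘ f) * (volContract o h (stdOrthonormalBasis ℝ V ∘ f)
        (stdOrthonormalBasis ℝ V ∘ g) : ℝ) := by
  classical
  set e := stdOrthonormalBasis ℝ V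
  have hfi : Function.Injective f := hfg.1.comp Sum.inl_injective
  rw [hodgeStar_apply]
  -- A multi-index that repeats a value or meets `g` contributes zero; the others are the
  -- rearrangements of `f`.
  have hsum : ∑ k : Fin p → Fin (finrank ℝ V),
      η (e ∘ k) * ((volContract o h (e ∘ k) (e ∘ g) : ℝ) : ℂ) =
      ∑ σ : Equiv.Perm (Fin p),
        η (e ∘ f ∘ σ) * ((volContract o h (e ∘ f ∘ σ) (e ∘ g) : ℝ) : ℂ) := by
    symm
    refine Finset.sum_of_injOn (fun σ => f ∘ σ) ?_ (by simp) ?_ (fun _ _ => rfl)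
    · intro σ _ τ _ hst
      ext1 a
      exact hfi (congrFun hst a)
    · intro k _ hk
      rw [volContract_eq_zero, Complex.ofReal_zero, mul_zero]
      intro hinj
      rw [← Sum.comp_elim] at hinj
      have hkg : Function.Injective (Sum.elim k g) := hinj.of_comp
      have hex : ∀ a, ∃ b, f b = k a := by
        intro a
        obtain ⟨b | b, hb⟩ := hfg.2 (k a)
        · exact ⟨b, hb⟩
        · have : Sum.elim k g (Sum.inl a) = Sum.elim k g (Sum.inr b) := hb.symm
          exact absurd (hkg this) (by simp)
      choose s hs using hex
      have hsi : Function.Injective s := fun a b hab => by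
        have : k a = k b := by rw [← hs, ← hs, hab]
        simpa using hkg (a₁ := Sum.inl a) (a₂ := Sum.inl b) this
      refine hk ⟨Equiv.ofBijective s (Finite.injective_iff_bijective.1 hsi), by simp, ?_⟩
      funext a
      exact hs a
  -- The sign of `σ` occurs in both factors and cancels, so the `p!` equal terms absorb the factor
  -- `1 / p!`.
  have hterm : ∀ σ : Equiv.Perm (Fin p),
      η (e ∘ f ∘ σ) * ((volContract o h (e ∘ f ∘ σ) (e ∘ g) : ℝ) : ℂ) =
        η (e ∘ f) * ((volContract o h (e ∘ f) (e ∘ g) : ℝ) : ℂ) := by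
    intro σ
    have h1 := η.toAlternatingMap.map_perm (e ∘ f) σ
    have h2 := volContract_comp_perm o h (e ∘ f) (e ∘ g) σ
    simp only [ContinuousAlternatingMap.coe_toAlternatingMap] at h1
    rw [← Function.comp_assoc, h1, h2, Units.smul_def, zsmul_eq_mul]
    rcases Int.units_eq_one_or (Equiv.Perm.sign σ) with hσ | hσ <;> simp [hσ]
  rw [hsum, Finset.sum_congr rfl fun σ _ => hterm σ, Finset.sum_const, Finset.card_univ,
    Fintype.card_perm, Fintype.card_fin, nsmul_eq_mul, ← mul_assoc, inv_mul_cancel₀, one_mul]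
  exact_mod_cast p.factorial_ne_zero

theorem ext_stdOrthonormalBasis {p : ℕ} {η ζ : V [⋀^Fin p]→L[ℝ] ℂ}
    (hηζ : ∀ g : Fin p → Fin (finrank ℝ V), Function.Injective g →
      η (stdOrthonormalBasis ℝ V ∘ g) = ζ (stdOrthonormalBasis ℝ V ∘ g)) : η = ζ := by
  apply ContinuousAlternatingMap.toAlternatingMap_injective
  refine Basis.ext_alternating (stdOrthonormalBasis ℝ V).toBasis fun g hg => ?_
  simpa [Function.comp_def] using hηζ g hg

theorem hodgeStar_smul (o : Orientation ℝ V (Fin n)) {p q : ℕ} (h : p + q = n) (c : ℂ)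
    (η : V [⋀^Fin p]→L[ℝ] ℂ) : hodgeStar o h (c • η) = c • hodgeStar o h η := by
  simp only [hodgeStar, ContinuousAlternatingMap.smul_apply, smul_assoc, ← Finset.smul_sum]
  rw [smul_comm]

theorem hodgeStar_add (o : Orientation ℝ V (Fin n)) {p q : ℕ} (h : p + q = n)
    (η ζ : V [⋀^Fin p]→L[ℝ] ℂ) :
    hodgeStar o h (η + ζ) = hodgeStar o h η + hodgeStar o h ζ := by
  ext v
  simp only [ContinuousAlternatingMap.add_apply, hodgeStar_apply, add_mul,
    Finset.sum_add_distrib, mul_add]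

theorem hodgeStar_hodgeStar (o : Orientation ℝ V (Fin n)) {p q : ℕ} (h : p + q = n)
    (h' : q + p = n) (η : V [⋀^Fin p]→L[ℝ] ℂ) :
    hodgeStar o h' (hodgeStar o h η) = (-1 : ℂ) ^ (p * q) • η := by
  refine ext_stdOrthonormalBasis fun g hg => ?_
  have hn : finrank ℝ V = n := Fact.out
  obtain ⟨f, hf⟩ := exists_bijective_elim (p := q) (by simp; omega) hg
  have hf' : Function.Bijective (Sum.elim g f) := by
    have := hf.comp (Equiv.sumComm (Fin p) (Fin q)).bijective
    convert! this using 1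
    funext s
    rcases s with a | b <;> rfl
  rw [hodgeStar_apply_basis o h' _ hf, hodgeStar_apply_basis o h _ hf',
    volContract_comm o h h' _ _]
  have := volContract_sq o h (stdOrthonormalBasis ℝ V) hf'
  rw [ContinuousAlternatingMap.smul_apply, smul_eq_mul, mul_assoc, ← Complex.ofReal_mul,
    mul_left_comm, this]
  push_cast
  ring

theorem form_eq_zero_of_lt {p : ℕ} (hp : n < p) (η : V [⋀^Fin p]→L[ℝ] ℂ) : η = 0 := by
  refine ext_stdOrthonormalBasis fun g hg => ?_
  have hn : finrank ℝ V = n := Fact.out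
  have := Fintype.card_le_of_injective g hg
  simp at this
  omega

theorem sharp_eq_sum (a : V [⋀^Fin 1]→L[ℝ] ℝ) :
    sharp a = ∑ j, functional a (stdOrthonormalBasis ℝ V j) • stdOrthonormalBasis ℝ V j := by
  rw [← (stdOrthonormalBasis ℝ V).sum_repr (sharp a)]
  refine Finset.sum_congr rfl fun j _ => ?_
  rw [OrthonormalBasis.repr_apply_apply, real_inner_comm, sharp,
    InnerProductSpace.toDual_symm_apply]

theorem wedge_apply {p : ℕ} (a : V [⋀^Fin 1]→L[ℝ] ℝ) (η : V [⋀^Fin p]→L[ℝ] ℂ)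
    (v : Fin (p + 1) → V) :
    wedge a η v = ∑ i : Fin (p + 1), (-1) ^ (i : ℕ) * (functional a (v i) : ℂ) *
      η (i.removeNth v) := by
  rw [wedge, ContinuousAlternatingMap.alternatizeUncurryFin_apply]
  refine Finset.sum_congr rfl fun i _ => ?_
  simp [mul_assoc]

theorem wedge_smul {p : ℕ} (a : V [⋀^Fin 1]→L[ℝ] ℝ) (c : ℂ) (η : V [⋀^Fin p]→L[ℝ] ℂ) :
    wedge a (c • η) = c • wedge a η := by
  ext v
  simp only [wedge_apply, ContinuousAlternatingMap.smul_apply, smul_eq_mul, Finset.mul_sum]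
  exact Finset.sum_congr rfl fun i _ => by ring

theorem interiorProd_smul {p : ℕ} (X : V) (c : ℂ) (η : V [⋀^Fin (p + 1)]→L[ℝ] ℂ) :
    interiorProd X (c • η) = c • interiorProd X η := rfl

theorem wedge_hodgeStar (o : Orientation ℝ V (Fin n)) {p q : ℕ} (h : p + 1 + q = n)
    (h' : p + (q + 1) = n) (a : V [⋀^Fin 1]→L[ℝ] ℝ) (η : V [⋀^Fin (p + 1)]→L[ℝ] ℂ) :
    wedge a (hodgeStar o h η) =
      (-1 : ℂ) ^ p • hodgeStar o h' (interiorProd (sharp a) η) := by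
  refine ext_stdOrthonormalBasis fun g hg => ?_
  have hn : finrank ℝ V = n := Fact.out
  obtain ⟨f, hf⟩ := exists_bijective_elim (p := p) (by simp; omega) hg
  rw [ContinuousAlternatingMap.smul_apply, hodgeStar_apply_basis o h' _ hf, wedge_apply]
  set e := stdOrthonormalBasis ℝ V
  -- Removing `g i` from `g` adds it to the complement `f`. Bringing `e (g i)` from slot `p + i` to
  -- the front gives `(-1)^(p+i)`, whose `(-1)^i` will cancel against the sign in `wedge`.
  have hleft : ∀ i : Fin (q + 1), hodgeStar o h η (i.removeNth (e ∘ g)) =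
      η (Matrix.vecCons (e (g i)) (e ∘ f)) *
        ((-1) ^ (p + i : ℕ) * (volContract o h' (e ∘ f) (e ∘ g) : ℝ)) := by
    intro i
    have hb : Function.Bijective
        (Sum.elim (Matrix.vecCons (g i) f) (i.removeNth g)) := by
      refine Function.Injective.bijective_of_nat_card_le ?_ (by simp; omega)
      refine Function.Injective.sumElim ?_ ?_ ?_
      · refine Fin.cons_injective_iff.2 ⟨?_, hf.1.comp Sum.inl_injective⟩
        rintro ⟨a, ha⟩
        have : Sum.elim f g (Sum.inl a) = Sum.elim f g (Sum.inr i) := ha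
        simpa using hf.1 this
      · exact hg.comp Fin.succAbove_right_injective
      · intro b c
        refine Fin.cases ?_ (fun b => ?_) b
        · intro hbc
          exact Fin.succAbove_ne i c (hg hbc).symm
        · intro hbc
          have : Sum.elim f g (Sum.inl b) = Sum.elim f g (Sum.inr (i.succAbove c)) := hbc
          simpa using hf.1 this
    have h1 : i.removeNth (e ∘ g) = e ∘ i.removeNth g := rfl
    have h2 : e ∘ Matrix.vecCons (g i) f = Matrix.vecCons (e (g i)) (e ∘ f) := by
      funext k
      refine Fin.cases ?_ (fun k => ?_) k <;> simp
    rw [h1, hodgeStar_apply_basis o h η hb, h2]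
    congr 1
    obtain ⟨m, rfl⟩ : ∃ m, n = m + 1 := ⟨p + q, by omega⟩
    rw [volContract_apply, volContract_apply, elim_vecCons_slots h (by omega : p + q = m),
      elim_slots_eq_insertNth h' (by omega : p + q = m) _ _ i, AlternatingMap.map_insertNth]
    have hi : ((slots h' (Sum.inr i) : Fin (m + 1)) : ℕ) = p + i := by simp [slots]
    rw [hi, h1]
    simp only [zsmul_eq_mul, Function.comp_apply]
    push_cast
    rw [← mul_assoc, ← pow_add, Even.neg_one_pow ⟨p + i, rfl⟩, one_mul]
  have hright : interiorProd (sharp a) η (e ∘ f) =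
      ∑ i : Fin (q + 1), (functional a (e (g i)) : ℂ) *
        η (Matrix.vecCons (e (g i)) (e ∘ f)) := by
    have hlin : interiorProd (sharp a) η (e ∘ f) =
        ∑ j, (functional a (e j) : ℂ) * η (Matrix.vecCons (e j) (e ∘ f)) := by
      rw [sharp_eq_sum]
      change η.curryLeft (∑ j, functional a (e j) • e j) (e ∘ f) = _
      rw [map_sum, ContinuousAlternatingMap.sum_apply]
      refine Finset.sum_congr rfl fun j _ => ?_
      rw [map_smul, ContinuousAlternatingMap.smul_apply, Complex.real_smul]
      rfl
    rw [hlin]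
    -- Components of `a^♯` along the vectors of `f` drop out, since `η` would see a repeated
    -- argument.
    symm
    refine Finset.sum_of_injOn g (fun _ _ _ _ hab => hg hab) (by simp) ?_ (fun _ _ => rfl)
    intro j _ hj
    obtain ⟨b | b, rfl⟩ := hf.2 j
    · rw [Sum.elim_inl, η.map_eq_zero_of_eq (Matrix.vecCons (e (f b)) (e ∘ f)) (i := 0) (j := b.succ)
        (by simp) (Fin.succ_ne_zero b).symm, mul_zero]
    · exact absurd ⟨b, by simp, rfl⟩ hj
  rw [hright, smul_eq_mul, Finset.sum_mul, Finset.mul_sum]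
  refine Finset.sum_congr rfl fun i _ => ?_
  rw [hleft i]
  have hs : (-1 : ℂ) ^ (i : ℕ) * (-1) ^ (i : ℕ) = 1 := by
    rw [← pow_add, Even.neg_one_pow ⟨_, rfl⟩]
  rw [pow_add]
  simp only [Function.comp_apply]
  linear_combination (functional a (e (g i)) : ℂ) * (η (Matrix.vecCons (e (g i)) (e ∘ f)) *
    ((-1) ^ p * (volContract o h' (e ∘ f) (e ∘ g) : ℝ))) * hs

theorem neg_one_pow_congr_of_even_iff {a b : ℕ} (h : Even a ↔ Even b) :
    (-1 : ℂ) ^ a = (-1) ^ b := by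
  rw [neg_one_pow_eq_ite, neg_one_pow_eq_ite, if_congr h rfl rfl]

/-- Follows from `wedge_hodgeStar` for `*η` by applying `*` once more and cancelling the double
stars. -/
theorem hodgeStar_wedge (o : Orientation ℝ V (Fin n)) {p q : ℕ} (h : p + 1 + q = n)
    (h' : p + (q + 1) = n) (a : V [⋀^Fin 1]→L[ℝ] ℝ) (η : V [⋀^Fin p]→L[ℝ] ℂ) :
    hodgeStar o h (wedge a η) =
      (-1 : ℂ) ^ p • interiorProd (sharp a) (hodgeStar o h' η) := by
  have h1 := wedge_hodgeStar o (p := q) (q := p) (by omega) (by omega) a (hodgeStar o h' η)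
  rw [hodgeStar_hodgeStar o h' (by omega), wedge_smul] at h1
  have h2 := congrArg (hodgeStar o h) h1
  rw [hodgeStar_smul, hodgeStar_smul, hodgeStar_hodgeStar o _ h, smul_smul] at h2
  have h3 := congrArg (fun ζ => (-1 : ℂ) ^ (p * (q + 1)) • ζ) h2
  simp only [smul_smul, ← pow_add] at h3
  rw [Even.neg_one_pow ⟨_, rfl⟩, one_smul] at h3
  rw [h3]
  congr 1
  apply neg_one_pow_congr_of_even_iff
  simp only [Nat.even_add, Nat.even_mul, Nat.not_even_one]
  tauto

end Linear

/-! ### Intertwining relations for forms on the manifold -/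

section Manifold

variable {E : Type*} [NormedAddCommGroup E] [NormedSpace ℝ E]
  {H : Type*} [TopologicalSpace H] {I : ModelWithCorners ℝ E H}
  {M : Type*} [TopologicalSpace M] [ChartedSpace H M]

theorem extD_smul {p : ℕ} (c : ℂ) (η : Form I M ℂ p) : extD (c • η) = c • extD η := by
  funext x
  have h1 : inChart (c • η) x = c • inChart η x := rfl
  have h2 : extDerivWithin (c • inChart η x) (range I) (extChartAt I x x) =
      c • extDerivWithin (inChart η x) (range I) (extChartAt I x x) := by
    -- Scalars from a field commute with `fderivWithin` even where the function is not
    -- differentiable; only unique differentiability of `range I` is needed.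
    have h3 := fderivWithin_const_smul_field (𝕜 := ℝ) (f := inChart η x) c
      (I.uniqueDiffOn _ (extChartAt_target_subset_range x (mem_extChartAt_target x)))
    rw [extDerivWithin, extDerivWithin, h3,
      ContinuousAlternatingMap.alternatizeUncurryFin_smul]
  rw [extD, h1, h2]
  rfl

variable [FiniteDimensional ℝ E] [IsManifold I 1 M]
  [RiemannianBundle fun x : M => TangentSpace I x] {n : ℕ} [Fact (finrank ℝ E = n)]

theorem formStar_smul (o : ManifoldOrientation I M n) {p q : ℕ} (h : p + q = n) (c : ℂ)
    (η : Form I M ℂ p) : formStar o h (c • η) = c • formStar o h η :=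
  funext fun x => hodgeStar_smul (o.at_ x) h c (η x)

theorem formStar_add (o : ManifoldOrientation I M n) {p q : ℕ} (h : p + q = n)
    (η ζ : Form I M ℂ p) : formStar o h (η + ζ) = formStar o h η + formStar o h ζ :=
  funext fun x => hodgeStar_add (o.at_ x) h (η x) (ζ x)

theorem formStar_formStar (o : ManifoldOrientation I M n) {p q : ℕ} (h : p + q = n)
    (h' : q + p = n) (η : Form I M ℂ p) :
    formStar o h' (formStar o h η) = (-1 : ℂ) ^ (p * q) • η :=
  funext fun x => hodgeStar_hodgeStar (o.at_ x) h h' (η x)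

theorem Form.eq_zero_of_lt {p : ℕ} (hp : n < p) (η : Form I M ℂ p) : η = 0 :=
  funext fun x => form_eq_zero_of_lt hp (η x)

/-- Replaces the truncated difference `n - (p + 1)` by any `q` known to equal it, avoiding casts
between degrees. -/
theorem codiff_eq (o : ManifoldOrientation I M n) {p q : ℕ} (h : p + 1 + q = n)
    (h' : q + 1 + p = n) (η : Form I M ℂ (p + 1)) :
    codiff o η = (-1 : ℂ) ^ (n * (p + 1 + 1) + 1) • formStar o h' (extD (formStar o h η)) := by
  obtain rfl : q = n - (p + 1) := by omega
  rw [codiff, dif_pos (by omega)]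

theorem codiff_smul (o : ManifoldOrientation I M n) {p : ℕ} (c : ℂ) (η : Form I M ℂ (p + 1)) :
    codiff o (c • η) = c • codiff o η := by
  by_cases h : p + 1 ≤ n
  · rw [codiff, codiff, dif_pos h, dif_pos h, formStar_smul, extD_smul, formStar_smul,
      smul_comm]
  · rw [codiff, codiff, dif_neg h, dif_neg h, smul_zero]

theorem magD_smul (α : Form I M ℝ 1) {p : ℕ} (c : ℂ) (η : Form I M ℂ p) :
    magD α (c • η) = c • magD α η := by
  funext x
  have h := wedge_smul (α x) c (η x)
  simp only [magD, extD_smul, Pi.add_apply, Pi.smul_apply, h, smul_add]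
  rw [smul_comm c Complex.I]

theorem magCodiff_smul (o : ManifoldOrientation I M n) (α : Form I M ℝ 1) {p : ℕ} (c : ℂ)
    (η : Form I M ℂ (p + 1)) : magCodiff o α (c • η) = c • magCodiff o α η := by
  funext x
  have h := interiorProd_smul (sharp (α x)) c (η x)
  simp only [magCodiff, codiff_smul, Pi.sub_apply, Pi.smul_apply, h, smul_sub]
  rw [smul_comm c Complex.I]

/-- The Hodge star intertwines `d^α` and `δ^α`, up to sign. -/
theorem magD_formStar (o : ManifoldOrientation I M n) (α : Form I M ℝ 1) {p q : ℕ}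
    (h : p + 1 + q = n) (h' : p + (q + 1) = n) (η : Form I M ℂ (p + 1)) :
    magD α (formStar o h η) = (-1 : ℂ) ^ (p + 1) • formStar o h' (magCodiff o α η) := by
  have h1 : extD (formStar o h η) = (-1 : ℂ) ^ (p + 1) • formStar o h' (codiff o η) := by
    rw [codiff_eq o h (by omega), formStar_smul, formStar_formStar, smul_smul, smul_smul,
      ← pow_add, ← pow_add, Even.neg_one_pow, one_smul]
    subst h
    simp only [Nat.even_add, Nat.even_mul, Nat.not_even_one]
    tauto
  funext x
  have h2 := wedge_hodgeStar (o.at_ x) h h' (α x) (η x)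
  have h3 : magCodiff o α η x =
    codiff o η x + (-Complex.I) • interiorProd (sharp (α x)) (η x) := by
    ext v
    exact sub_eq_add_neg _ _ |>.trans (congrArg _ (neg_mul _ _).symm)
  have h4 : magD α (formStar o h η) x =
    extD (formStar o h η) x + Complex.I • wedge (α x) (hodgeStar (o.at_ x) h (η x)) := rfl
  have h5 : formStar o h' (magCodiff o α η) x = formStar o h' (codiff o η) x +
      (-Complex.I) • hodgeStar (o.at_ x) h' (interiorProd (sharp (α x)) (η x)) := by
    rw [formStar, h3, hodgeStar_add, hodgeStar_smul]; rfl
  rw [h4, h1, h2, Pi.smul_apply, Pi.smul_apply, h5, smul_add, smul_smul, smul_smul]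
  congr 2
  ring

theorem magCodiff_formStar (o : ManifoldOrientation I M n) (α : Form I M ℝ 1) {p q : ℕ}
    (h : p + (q + 1) = n) (h' : p + 1 + q = n) (η : Form I M ℂ p) :
    magCodiff o α (formStar o h η) = (-1 : ℂ) ^ (p + 1) • formStar o h' (magD α η) := by
  have h1 : codiff o (formStar o h η) = (-1 : ℂ) ^ (p + 1) • formStar o h' (extD η) := by
    rw [codiff_eq o (by omega : q + 1 + p = n) h', formStar_formStar, extD_smul, formStar_smul,
      smul_smul, ← pow_add]
    congr 1
    apply neg_one_pow_congr_of_even_iff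
    subst h
    simp only [Nat.even_add, Nat.even_mul, Nat.not_even_one]
    tauto
  funext x
  have h2 := hodgeStar_wedge (o.at_ x) h' h (α x) (η x)
  have h3 : magCodiff o α (formStar o h η) x = codiff o (formStar o h η) x +
      (-Complex.I) • interiorProd (sharp (α x)) (hodgeStar (o.at_ x) h (η x)) := by
    ext v
    exact sub_eq_add_neg _ _ |>.trans (congrArg _ (neg_mul _ _).symm)
  have h4 : magD α η x = extD η x + Complex.I • wedge (α x) (η x) := rfl
  have h5 : formStar o h' (magD α η) x = formStar o h' (extD η) x +
      Complex.I • hodgeStar (o.at_ x) h' (wedge (α x) (η x)) := by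
    rw [formStar, h4, hodgeStar_add, hodgeStar_smul]; rfl
  have hs : (-1 : ℂ) ^ p * (-1) ^ p = 1 := by
    rw [← pow_add, Even.neg_one_pow ⟨_, rfl⟩]
  rw [h3, h1, Pi.smul_apply, Pi.smul_apply, h5, h2, smul_add, smul_smul, smul_smul]
  congr 2
  rw [pow_succ]
  linear_combination Complex.I * hs

theorem magD_magCodiff_formStar (o : ManifoldOrientation I M n) (α : Form I M ℝ 1) {p q : ℕ}
    (h : p + (q + 1) = n) (η : Form I M ℂ p) :
    magD α (magCodiff o α (formStar o h η)) = formStar o h (magCodiff o α (magD α η)) := by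
  rw [magCodiff_formStar o α h (by omega), magD_smul, magD_formStar o α (by omega) h, smul_smul,
    ← pow_add, Even.neg_one_pow ⟨_, rfl⟩, one_smul]

theorem magCodiff_magD_formStar (o : ManifoldOrientation I M n) (α : Form I M ℝ 1) {p q : ℕ}
    (h : p + 1 + q = n) (η : Form I M ℂ (p + 1)) :
    magCodiff o α (magD α (formStar o h η)) = formStar o h (magD α (magCodiff o α η)) := by
  rw [magD_formStar o α h (by omega), magCodiff_smul, magCodiff_formStar o α (by omega) h,
    smul_smul, ← pow_add, Even.neg_one_pow ⟨_, rfl⟩, one_smul]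

theorem magCodiff_magD_of_degree_eq (o : ManifoldOrientation I M n) (α : Form I M ℝ 1) {p : ℕ}
    (hp : p = n) (η : Form I M ℂ p) : magCodiff o α (magD α η) = 0 := by
  rw [Form.eq_zero_of_lt (n := n) (by omega) (magD α η)]
  simpa using magCodiff_smul o α 0 (0 : Form I M ℂ (p + 1))

end Manifold

end

end MagneticHodge

theorem corollary3p2
    {E : Type*} [NormedAddCommGroup E] [NormedSpace ℝ E] [FiniteDimensional ℝ E]
    {n : ℕ} [Fact (Module.finrank ℝ E = n)]
    {H : Type*} [TopologicalSpace H] (I : ModelWithCorners ℝ E H)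
    (M : Type*) [TopologicalSpace M] [ChartedSpace H M] [IsManifold I ∞ M]
    [RiemannianBundle fun x : M => TangentSpace I x]
    [IsContMDiffRiemannianBundle I ∞ E fun x : M => TangentSpace I x]
    (o : MagneticHodge.ManifoldOrientation I M n)
    (α : MagneticHodge.Form I M ℝ 1) (hα : MagneticHodge.IsSmoothForm α)
    {p q : ℕ} (h : p + q = n)
    (η : MagneticHodge.Form I M ℂ p) (hη : MagneticHodge.IsSmoothForm η) :
    MagneticHodge.magLaplacian o α (MagneticHodge.formStar o h η) =
      MagneticHodge.formStar o h (MagneticHodge.magLaplacian o α η) := by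
  have star_zero : MagneticHodge.formStar o h (0 : MagneticHodge.Form I M ℂ p) = 0 := by
    simpa using MagneticHodge.formStar_smul o h 0 (0 : MagneticHodge.Form I M ℂ p)
  -- In degree `0` the summand `d^α δ^α` is absent; its counterpart under `*` is `δ^α d^α` in degree
  -- `n`, which vanishes because it passes through degree `n + 1`.
  rcases p with _ | p <;> rcases q with _ | q <;> simp only [MagneticHodge.magLaplacian]
  · rw [MagneticHodge.magCodiff_magD_of_degree_eq o α (by omega),
      MagneticHodge.magCodiff_magD_of_degree_eq o α (by omega), star_zero]
  · rw [MagneticHodge.magCodiff_magD_of_degree_eq o α (by omega) (MagneticHodge.formStar o h η),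
      add_zero, MagneticHodge.magD_magCodiff_formStar]
  · rw [MagneticHodge.magCodiff_magD_of_degree_eq o α (by omega) η, add_zero,
      MagneticHodge.magCodiff_magD_formStar]
  · rw [MagneticHodge.formStar_add, MagneticHodge.magD_magCodiff_formStar,
      MagneticHodge.magCodiff_magD_formStar]
    exact add_comm _ _
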